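/- An incremental graph sequence of length $T$ consists of an initial finite simple undirected edge-weighted graph $G_0$ and graphs $G_1,\dots,G_T$, where each $G_t=(V_t,E_t,w)$ arises from $G_{t-1}$ by inserting a set of new nodes and a set of new weighted edges; nothing is ever deleted and weights do not change. Two incremental graph sequences $\mathcal G,\mathcal G'$ of the same length and with the same initial graph are node-adjacent if, up to exchanging them, there are a node $v^*$ and a time $t^*$ such that: $v^*$ is inserted into $\mathcal G$ at time $t^*$; $\mathcal G'$ inserts the same nodes at the same times except that it omits the insertion of $v^*$; every edge inserted into $\mathcal G$ at a time $t$ is incident to a node inserted into $\mathcal G$ at time $t$; and the edges inserted into $\mathcal G'$ at time $t$ are exactly the edges inserted into $\mathcal G$ at time $t$ that are not incident to $v^*$, with the same weights. Let $w_{\mathrm{MST}}(G)$ be the weight of a minimum spanning tree of $G$ (of a minimum spanning forest if $G$ is disconnected). For $D,W,T\in\mathbb N$ let $\mathcal S_{D,W,T}$ be the set of incremental graph sequences of length $T$ in which all graphs $G_0,\dots,G_T$ have maximum degree at most $D$ and edge weights in $\{1,\dots,W\}$. An algorithm under continual observation reads $G_0,G_1,\dots,G_T$ and outputs a real number $a_t$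 at every time $t=1,\dots,T$, which depends only on its random coins and on $G_0,\dots,G_t$. It is $\varepsilon$-node-differentially private on $\mathcal S_{D,W,T}$ if $\Pr[a(\mathcal G)\in B]\le e^{\varepsilon}\Pr[a(\mathcal G')\in B]$ for all node-adjacent $\mathcal G,\mathcal G'\in\mathcal S_{D,W,T}$ and all measurable $B\subseteq\mathbb R^T$, where $a=(a_1,\dots,a_T)$. **Theorem.** (i) For all $D,W,T$, the continuous global sensitivity of the difference sequence of the minimum spanning tree weight on $\mathcal S_{D,W,T}$ under node-adjacency is at most $2DW$, that is, $$\sum_{t=1}^{T}\bigl|\bigl(w_{\mathrm{MST}}(G_t)-w_{\mathrm{MST}}(G_{t-1})\bigr)-\bigl(w_{\mathrm{MST}}(G'_t)-w_{\mathrm{MST}}(G'_{t-1})\bigr)\bigr|\le 2DW$$ for all node-adjacent $\mathcal G,\mathcal G'\in\mathcal S_{D,W,T}$. (ii) There is an absolute constant $C>0$ such that for all $T\ge 2$, all $D,W\in\mathbb N$ and all $\varepsilon>0$ there is an algorithm under continual observation that is $\varepsilon$-node-differentially private on $\mathcal S_{D,W,T}$ and such that for every $\delta\in(0,1)$, every $\mathcal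 G\in\mathcal S_{D,W,T}$ and every time $t\in\{1,\dots,T\}$, with probability at least $1-\delta$, $$\bigl|a_t-w_{\mathrm{MST}}(G_t)\bigr|\le C\cdot D\,W\,\varepsilon^{-1}\,\log^{3/2}T\,\log\delta^{-1}.$$ -/

import Mathlib

open MeasureTheory
open scoped ENNReal

/-- A finite simple undirected edge-weighted graph `(V, E, w)` whose nodes are taken from a universe
`V` of possible nodes. The weight function `w : E → ℕ` is stored as a function on all pairs that
vanishes outside `E`, so that two such graphs are equal iff they have the same nodes, the same edges
and the same edge weights. -/
@[ext]
structure WeightedGraph (V : Type*) where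
  verts : Finset V
  edges : Finset (Sym2 V)
  weight : Sym2 V → ℕ
  loopless : ∀ e ∈ edges, ¬ e.IsDiag
  endpoints_mem : ∀ e ∈ edges, ∀ v ∈ e, v ∈ verts
  weight_eq_zero : ∀ e, e ∉ edges → weight e = 0

namespace WeightedGraph

variable {V : Type*}

/-- `F` is the edge set of a spanning forest of `G`, i.e. of a spanning tree of every connected
component of `G`. If `G` is connected, these are exactly the spanning trees of `G`. -/
def IsSpanningForest (G : WeightedGraph V) (F : Finset (Sym2 V)) : Prop :=
  F ⊆ G.edges ∧
  (SimpleGraph.fromEdgeSet (F : Set (Sym2 V))).IsAcyclic ∧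
  ∀ u v : V, (SimpleGraph.fromEdgeSet (G.edges : Set (Sym2 V))).Reachable u v →
    (SimpleGraph.fromEdgeSet (F : Set (Sym2 V))).Reachable u v

/-- A spanning forest always exists, so the infimum in `mstWeight` is a minimum. -/
theorem exists_isSpanningForest (G : WeightedGraph V) : ∃ F, G.IsSpanningForest F := by
  obtain ⟨H, hle, hac, hr⟩ :=
    (SimpleGraph.fromEdgeSet (G.edges : Set (Sym2 V))).exists_isAcyclic_reachable_eq_le
  have hsub : H.edgeSet ⊆ (G.edges : Set (Sym2 V)) := by
    intro e he
    have h1 := SimpleGraph.edgeSet_mono hle he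
    rw [SimpleGraph.edgeSet_fromEdgeSet] at h1
    exact h1.1
  have hfin : H.edgeSet.Finite := G.edges.finite_toSet.subset hsub
  have hF : SimpleGraph.fromEdgeSet (hfin.toFinset : Set (Sym2 V)) = H := by
    rw [Set.Finite.coe_toFinset, SimpleGraph.fromEdgeSet_edgeSet]
  refine ⟨hfin.toFinset, ?_, ?_, ?_⟩
  · intro e he
    exact hsub (hfin.mem_toFinset.mp he)
  · rw [hF]
    exact hac
  · intro u v huv
    rw [hF, hr]
    exact huv

/-- The weight of a minimum spanning tree (of a minimum spanning forest, if `G` is not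
connected). -/
noncomputable def mstWeight (G : WeightedGraph V) : ℕ :=
  sInf {n : ℕ | ∃ F : Finset (Sym2 V), G.IsSpanningForest F ∧ n = ∑ e ∈ F, G.weight e}

/-- The degree of a node. -/
noncomputable def degree (G : WeightedGraph V) (v : V) : ℕ :=
  {e : Sym2 V | e ∈ G.edges ∧ v ∈ e}.ncard

end WeightedGraph

/-- An incremental graph sequence `(G₁, …, G_T)` of length `T` with initial graph `G₀`: the graph
`G_t` is `graph t`, and it is derived from `G_{t-1}` by inserting nodes and (weighted) edges only. -/
structure IncrementalSeq (V : Type*) (T : ℕ) where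
  graph : Fin (T + 1) → WeightedGraph V
  verts_subset : ∀ t : Fin T, (graph t.castSucc).verts ⊆ (graph t.succ).verts
  edges_subset : ∀ t : Fin T, (graph t.castSucc).edges ⊆ (graph t.succ).edges
  weight_eq : ∀ t : Fin T, ∀ e ∈ (graph t.castSucc).edges,
    (graph t.succ).weight e = (graph t.castSucc).weight e

namespace IncrementalSeq

variable {V : Type*} {T : ℕ}

/-- The set of nodes inserted by the update that leads from `graph t.castSucc` to `graph t.succ`. -/
def insertedVerts (S : IncrementalSeq V T) (t : Fin T) : Set V :=
  {v | v ∈ (S.graph t.succ).verts ∧ v ∉ (S.graph t.castSucc).verts}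

/-- The set of edges inserted by the update that leads from `graph t.castSucc` to
`graph t.succ`. -/
def insertedEdges (S : IncrementalSeq V T) (t : Fin T) : Set (Sym2 V) :=
  {e | e ∈ (S.graph t.succ).edges ∧ e ∉ (S.graph t.castSucc).edges}

/-- All degrees are at most `D` and all edge weights are in `{1, …, W}`, at all times. -/
def Bounded (S : IncrementalSeq V T) (D W : ℕ) : Prop :=
  ∀ t : Fin (T + 1),
    (∀ v : V, (S.graph t).degree v ≤ D) ∧
    (∀ e ∈ (S.graph t).edges, 1 ≤ (S.graph t).weight e ∧ (S.graph t).weight e ≤ W)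

/-- `S` and `S'` start from the same graph, and `S'` arises from `S` by omitting the insertion of
one node `vstar`, together with all edges incident to it. All edges are inserted together with at
least one of their endpoints. -/
def NodeAdjacentOn (S S' : IncrementalSeq V T) (vstar : V) : Prop :=
  S.graph 0 = S'.graph 0 ∧
  (∃ tstar : Fin T,
    vstar ∈ S.insertedVerts tstar ∧
    S'.insertedVerts tstar = S.insertedVerts tstar \ {vstar} ∧
    ∀ t : Fin T, t ≠ tstar → S'.insertedVerts t = S.insertedVerts t) ∧
  (∀ t : Fin T, ∀ e ∈ S.insertedEdges t, ∃ v ∈ e, v ∈ S.insertedVerts t) ∧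
  (∀ t : Fin T, S'.insertedEdges t = {e | e ∈ S.insertedEdges t ∧ vstar ∉ e}) ∧
  (∀ t : Fin T, ∀ e ∈ S'.insertedEdges t,
    (S'.graph t.succ).weight e = (S.graph t.succ).weight e)

/-- Node-adjacency (on event-level), a symmetric relation. -/
def NodeAdjacent (S S' : IncrementalSeq V T) : Prop :=
  ∃ vstar : V, NodeAdjacentOn S S' vstar ∨ NodeAdjacentOn S' S vstar

/-- The difference sequence `Δf(t) = f(G_t) - f(G_{t-1})` of a graph function `f`. -/
def diffSeq (f : WeightedGraph V → ℝ) (S : IncrementalSeq V T) (t : Fin T) : ℝ :=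
  f (S.graph t.succ) - f (S.graph t.castSucc)

end IncrementalSeq

/-- The continuous global sensitivity of the difference sequence of `f` under node-adjacency, on
incremental graph sequences of length `T` with maximum degree at most `D` and edge weights in
`{1, …, W}`. -/
noncomputable def nodeSensitivity {V : Type*} (f : WeightedGraph V → ℝ) (T D W : ℕ) : ℝ≥0∞ :=
  ⨆ (S : IncrementalSeq V T) (S' : IncrementalSeq V T)
    (_ : S.Bounded D W ∧ S'.Bounded D W ∧ S.NodeAdjacent S'),
    ENNReal.ofReal (∑ t : Fin T, |S.diffSeq f t - S'.diffSeq f t|)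

/-- A randomized algorithm under continual observation, for incremental graph sequences of length
`T`. It draws its random coins from a probability space, reads the graph sequence, and outputs a
real number at each time `1, …, T`, where its output at a time depends only on its coins and on the
part of the sequence seen so far. -/
structure ContinualAlgorithm (V : Type*) (T : ℕ) where
  Coins : Type
  [measurableSpace : MeasurableSpace Coins]
  law : Measure Coins
  [isProbabilityMeasure : IsProbabilityMeasure law]
  output : IncrementalSeq V T → Coins → Fin T → ℝ
  measurable_output : ∀ S, Measurable (output S)
  causal : ∀ (S S' : IncrementalSeq V T) (t : Fin T),
    (∀ s : Fin (T + 1), s ≤ t.succ → S.graph s = S'.graph s) →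
    ∀ ω, output S ω t = output S' ω t

namespace ContinualAlgorithm

variable {V : Type*} {T : ℕ}

/-- The probability that the random outcome `ω` of the coins satisfies `p`. -/
noncomputable def pr (A : ContinualAlgorithm V T) (p : A.Coins → Prop) : ℝ :=
  (@Measure.real A.Coins A.measurableSpace A.law {ω | p ω})

/-- `A` is `ε`-node-differentially private on incremental graph sequences with maximum degree at
most `D` and edge weights in `{1, …, W}`. -/
def NodePrivate (A : ContinualAlgorithm V T) (ε : ℝ) (D W : ℕ) : Prop :=
  ∀ S S' : IncrementalSeq V T, S.Bounded D W → S'.Bounded D W → S.NodeAdjacent S' →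
    ∀ B : Set (Fin T → ℝ), MeasurableSet B →
      A.pr (fun ω => A.output S ω ∈ B) ≤ Real.exp ε * A.pr (fun ω => A.output S' ω ∈ B)

end ContinualAlgorithm

/-!
The edges of a graph form a linear matroid, represented by their incidence vectors over `ZMod 2`. By
Kruskal's algorithm, `w_MST(G)` is the sum over `0 ≤ i < W` of `r(E) - r(E_{≤ i})`, where `r` is the
rank and `E_{≤ i}` is the set of edges of weight at most `i`. Write `n(A) = |A| - r(A)` for the
nullity and `g(A) = n(A) - n(A \ star(v))` for the nullity contributed by the edges at the node `v`.
If `G'` arises from `G` by deleting `v`, then the `i`-th summands of `G` and `G'` differ by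
`|star(v) ∩ E_{> i}| + g(E_{≤ i}) - g(E)`. As the rank is submodular, `g` is monotone in the edge
set, so along an incremental sequence this is a difference of two nondecreasing sequences, the sum
of whose final values is at most `2 deg(v) ≤ 2D`. Summation over `i` bounds the total variation of
`w_MST(G_t) - w_MST(G'_t)` by `2DW`.

For the algorithm, a sequence of total variation `R` has dyadic increments of `ℓ¹`-norm at most
`(log₂ T + 1) R`, so Laplace noise of scale `(log₂ T + 1) R / ε` at every dyadic block is private,
and at each time only `log₂ T + 1` noises are added up. Chernoff's bound for their sum gives an
exponential tail, but with a constant in front that makes the bound void for `δ` near `1`. There a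
uniform noise of the same order of magnitude, which cannot hurt privacy, is enough: whatever the
Laplace noise, the error is at most a small `r` with probability of order `r`.
-/

section FamilyRank

variable {K ι M : Type*} [DivisionRing K] [AddCommGroup M] [Module K M] {v : ι → M}
  {A B E F : Finset ι}

open Submodule Finset

variable (K v) in
/-- The rank of the subfamily of `v` indexed by `A`, that is, the rank function of the linear
matroid represented by `v`. -/
noncomputable def familyRank (A : Finset ι) : ℕ :=
  Set.finrank K (v '' (A : Set ι))

variable (K v) in
/-- The nullity of the subfamily of `v` indexed by `A`, that is, the dimension of the space of
linear relations between its members. For the incidence vectors of a graph this is the cyclomatic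
number. The subtraction never truncates, see `familyRank_add_familyNullity`. -/
noncomputable def familyNullity (A : Finset ι) : ℕ :=
  #A - familyRank K v A

theorem familyRank_le_card (A : Finset ι) : familyRank K v A ≤ #A := by
  classical
  rw [familyRank, ← coe_image]
  exact (finrank_span_finset_le_card _).trans card_image_le

theorem familyRank_add_familyNullity (A : Finset ι) :
    familyRank K v A + familyNullity K v A = #A :=
  Nat.add_sub_of_le (familyRank_le_card A)

theorem familyRank_eq_card (hA : LinearIndepOn K v (A : Set ι)) : familyRank K v A = #A := by
  have h := finrank_span_eq_card (b := fun i : (A : Set ι) => v i) hA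
  rw [← Set.image_eq_range] at h
  simpa [familyRank, Set.finrank] using h

theorem finiteDimensional_span_image (v : ι → M) (A : Finset ι) :
    FiniteDimensional K (span K (v '' (A : Set ι))) :=
  FiniteDimensional.span_of_finite _ (A.finite_toSet.image _)

theorem familyRank_le_of_subset_span (h : v '' (A : Set ι) ⊆ span K (v '' (B : Set ι))) :
    familyRank K v A ≤ familyRank K v B :=
  have := finiteDimensional_span_image (K := K) v B
  finrank_mono (span_le.2 h)

theorem familyRank_mono (h : A ⊆ B) : familyRank K v A ≤ familyRank K v B :=
  familyRank_le_of_subset_span ((Set.image_mono (coe_subset.2 h)).trans subset_span)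

theorem familyRank_union_add_familyRank_inter_le [DecidableEq ι] (A B : Finset ι) :
    familyRank K v (A ∪ B) + familyRank K v (A ∩ B) ≤ familyRank K v A + familyRank K v B := by
  have := finiteDimensional_span_image (K := K) v A
  have := finiteDimensional_span_image (K := K) v B
  have h_sup_inf := finrank_sup_add_finrank_inf_eq
    (span K (v '' (A : Set ι))) (span K (v '' (B : Set ι)))
  rw [← span_union, ← Set.image_union, ← coe_union] at h_sup_inf
  have h_inter : span K (v '' ((A ∩ B : Finset ι) : Set ι)) ≤
      span K (v '' (A : Set ι)) ⊓ span K (v '' (B : Set ι)) :=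
    le_inf (span_mono (Set.image_mono (coe_subset.2 inter_subset_left)))
      (span_mono (Set.image_mono (coe_subset.2 inter_subset_right)))
  exact (Nat.add_le_add_left (finrank_mono h_inter) _).trans h_sup_inf.le

theorem familyNullity_add_familyNullity_le [DecidableEq ι] (A B : Finset ι) :
    familyNullity K v A + familyNullity K v B ≤
      familyNullity K v (A ∪ B) + familyNullity K v (A ∩ B) := by
  have h_rank := familyRank_union_add_familyRank_inter_le (K := K) (v := v) A B
  have h_card := card_union_add_card_inter A B
  simp only [← familyRank_add_familyNullity (K := K) (v := v)] at h_card
  omega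

theorem familyNullity_mono (h : A ⊆ B) : familyNullity K v A ≤ familyNullity K v B := by
  classical
  have h_add := familyNullity_add_familyNullity_le (K := K) (v := v) A (B \ A)
  have h_empty : familyNullity K v ∅ = 0 := by simp [familyNullity]
  rw [union_sdiff_of_subset h, inter_sdiff_self, h_empty] at h_add
  omega

section NullityGain

variable {p : ι → Prop} [DecidablePred p]

variable (K v p) in
/-- The nullity that a subfamily gains from its members with property `p`. -/
noncomputable def nullityGain (A : Finset ι) : ℝ :=
  familyNullity K v A - familyNullity K v (A.filter (¬ p ·))

theorem nullityGain_mono : Monotone (nullityGain K v p) := by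
  classical
  intro A B h
  have h_super := familyNullity_add_familyNullity_le (K := K) (v := v) A (B.filter (¬ p ·))
  have h_union : A ∪ B.filter (¬ p ·) ⊆ B := union_subset h (filter_subset _ _)
  have h_inter : A ∩ B.filter (¬ p ·) = A.filter (¬ p ·) := by grind
  have h_mono := familyNullity_mono (K := K) (v := v) h_union
  rw [h_inter] at h_super
  have : (familyNullity K v A + familyNullity K v (B.filter (¬ p ·)) : ℝ) ≤
      familyNullity K v B + familyNullity K v (A.filter (¬ p ·)) := by
    exact_mod_cast h_super.trans (Nat.add_le_add_right h_mono _)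
  unfold nullityGain
  linarith

theorem nullityGain_le_card_filter (A : Finset ι) : nullityGain K v p A ≤ #(A.filter p) := by
  have h_rank := familyRank_mono (K := K) (v := v) (filter_subset (¬ p ·) A)
  have h_card := card_filter_add_card_filter_not (s := A) p
  have h_all := familyRank_add_familyNullity (K := K) (v := v) A
  have h_rest := familyRank_add_familyNullity (K := K) (v := v) (A.filter (¬ p ·))
  have : (familyNullity K v A : ℝ) ≤ #(A.filter p) + familyNullity K v (A.filter (¬ p ·)) := by
    exact_mod_cast (by omega)
  unfold nullityGain
  linarith

theorem nullityGain_nonneg (A : Finset ι) : 0 ≤ nullityGain K v p A :=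
  sub_nonneg.2 (Nat.cast_le.2 (familyNullity_mono (filter_subset _ _)))

end NullityGain

variable (K v) in
/-- `F` indexes a basis of the span of the subfamily of `v` indexed by `E`, that is, `F` is a basis
of `E` in the linear matroid represented by `v`. -/
structure IsSubfamilyBasis (E F : Finset ι) : Prop where
  subset : F ⊆ E
  linearIndepOn : LinearIndepOn K v (F : Set ι)
  image_subset_span : v '' (E : Set ι) ⊆ span K (v '' (F : Set ι))

theorem IsSubfamilyBasis.card_eq (h : IsSubfamilyBasis K v E F) : #F = familyRank K v E := by
  rw [← familyRank_eq_card h.linearIndepOn]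
  exact le_antisymm (familyRank_mono h.subset) (familyRank_le_of_subset_span h.image_subset_span)

/-- Kruskal's greedy algorithm: scan `E` by increasing weight and keep the elements that are
independent of those kept before. -/
theorem exists_forall_isSubfamilyBasis_sublevel {α : Type*} [LinearOrder α] (w : ι → α)
    (E : Finset ι) :
    ∃ F ⊆ E, ∀ i, IsSubfamilyBasis K v (E.filter (w · ≤ i)) (F.filter (w · ≤ i)) := by
  classical
  suffices ∃ F ⊆ E, LinearIndepOn K v (F : Set ι) ∧
      ∀ i, v '' (E.filter (w · ≤ i)) ⊆ span K (v '' (F.filter (w · ≤ i))) by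
    obtain ⟨F, hFE, h_indep, h_span⟩ := this
    exact ⟨F, hFE, fun i => ⟨filter_subset_filter _ hFE,
      h_indep.mono (coe_subset.2 (filter_subset _ _)), h_span i⟩⟩
  induction E using Finset.induction_on_max_value w with
  | empty => exact ⟨∅, Subset.rfl, by simp, by simp⟩
  | insert a s _ h_max ih =>
    obtain ⟨F, hFs, h_indep, h_span⟩ := ih
    obtain ⟨F', hFF', hF'F, h_indep', ha⟩ : ∃ F', F ⊆ F' ∧ F' ⊆ insert a F ∧
        LinearIndepOn K v (F' : Set ι) ∧ v a ∈ span K (v '' (F' : Set ι)) := by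
      by_cases ha : v a ∈ span K (v '' (F : Set ι))
      · exact ⟨F, Subset.rfl, subset_insert _ _, h_indep, ha⟩
      · refine ⟨insert a F, subset_insert _ _, Subset.rfl, ?_, ?_⟩
        · simpa only [coe_insert] using h_indep.insert ha
        · exact subset_span (Set.mem_image_of_mem _ (mem_insert_self _ _))
    refine ⟨F', hF'F.trans (insert_subset_insert _ hFs), h_indep', fun i => ?_⟩
    rintro _ ⟨e, he, rfl⟩
    obtain ⟨he, hei⟩ := mem_filter.1 he
    rcases mem_insert.1 he with rfl | hes
    · rwa [filter_true_of_mem]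
      intro x hx
      rcases mem_insert.1 (hF'F hx) with rfl | hxF
      exacts [hei, (h_max _ (hFs hxF)).trans hei]
    · exact span_mono (Set.image_mono (coe_subset.2 (filter_subset_filter _ hFF')))
        (h_span i ⟨e, mem_filter.2 ⟨hes, hei⟩, rfl⟩)

theorem sum_eq_sum_card_filter_lt {w : ι → ℕ} {W : ℕ} (hw : ∀ e ∈ F, w e ≤ W) :
    ∑ e ∈ F, w e = ∑ i ∈ range W, #(F.filter (i < w ·)) := by
  simp only [card_filter]
  rw [sum_comm]
  refine sum_congr rfl fun e he => ?_
  rw [← card_filter]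
  have h_below : (range W).filter (· < w e) = range (w e) := by
    have := hw e he
    grind
  rw [h_below, card_range]

theorem isLeast_sum_isSubfamilyBasis {w : ι → ℕ} {W : ℕ} (hw : ∀ e ∈ E, w e ≤ W) :
    IsLeast {n | ∃ F, IsSubfamilyBasis K v E F ∧ n = ∑ e ∈ F, w e}
      (∑ i ∈ range W, (familyRank K v E - familyRank K v (E.filter (w · ≤ i)))) := by
  have h_above : ∀ F, IsSubfamilyBasis K v E F → ∀ i,
      #(F.filter (i < w ·)) = familyRank K v E - familyRank K v (F.filter (w · ≤ i)) := by
    intro F hF i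
    have h_split := card_filter_add_card_filter_not (s := F) (w · ≤ i)
    simp only [not_le] at h_split
    rw [familyRank_eq_card (hF.linearIndepOn.mono (coe_subset.2 (filter_subset _ F))), ← hF.card_eq]
    omega
  constructor
  · obtain ⟨F, hFE, hF⟩ := exists_forall_isSubfamilyBasis_sublevel (K := K) (v := v) w E
    have hF_all : IsSubfamilyBasis K v E F := by
      have := hF W
      rwa [filter_true_of_mem hw, filter_true_of_mem fun e he => hw e (hFE he)] at this
    refine ⟨F, hF_all, ?_⟩
    rw [sum_eq_sum_card_filter_lt fun e he => hw e (hFE he)]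
    refine sum_congr rfl fun i _ => ?_
    rw [h_above F hF_all, ← (hF i).card_eq, familyRank_eq_card (hF i).linearIndepOn]
  · rintro _ ⟨F, hF, rfl⟩
    rw [sum_eq_sum_card_filter_lt fun e he => hw e (hF.subset he)]
    refine sum_le_sum fun i _ => ?_
    rw [h_above F hF]
    exact Nat.sub_le_sub_left (familyRank_mono (filter_subset_filter _ hF.subset)) _

theorem familyRank_sub_familyRank_filter_not (p : ι → Prop) [DecidablePred p] (E : Finset ι) :
    ((familyRank K v E - familyRank K v (E.filter (¬ p ·)) : ℕ) : ℝ) =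
      #(E.filter p) - nullityGain K v p E := by
  have h_card := card_filter_add_card_filter_not (s := E) p
  have h_all := familyRank_add_familyNullity (K := K) (v := v) E
  have h_rest := familyRank_add_familyNullity (K := K) (v := v) (E.filter (¬ p ·))
  rw [Nat.cast_sub (familyRank_mono (filter_subset _ _)), nullityGain]
  have : (familyRank K v E + familyNullity K v E : ℝ) = #(E.filter p) +
      (familyRank K v (E.filter (¬ p ·)) + familyNullity K v (E.filter (¬ p ·))) := by
    exact_mod_cast (by omega)
  linarith

end FamilyRank

section GraphicMatroid

variable {V : Type*}

open Submodule

/-- The incidence vector of an edge over `ZMod 2`, zero on loops. These vectors represent the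
graphic matroid: forests are the linearly independent sets of edges. -/
noncomputable def incidenceVec (e : Sym2 V) : V →₀ ZMod 2 :=
  Sym2.lift ⟨fun u v => Finsupp.single u 1 + Finsupp.single v 1, fun _ _ => add_comm _ _⟩ e

theorem incidenceVec_mk (u v : V) :
    incidenceVec s(u, v) = Finsupp.single u (1 : ZMod 2) + Finsupp.single v 1 := rfl

theorem incidenceVec_self (u : V) : incidenceVec s(u, u) = 0 := by
  rw [incidenceVec_mk, ← Finsupp.single_add, CharTwo.add_self_eq_zero, Finsupp.single_zero]

theorem incidenceVec_add_incidenceVec (u v w : V) :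
    incidenceVec s(u, v) + incidenceVec s(v, w) = incidenceVec s(u, w) := by
  have h_cancel := incidenceVec_self v
  simp only [incidenceVec_mk] at h_cancel ⊢
  rw [add_assoc, ← add_assoc (Finsupp.single v 1), h_cancel, zero_add]

theorem incidenceVec_mem_span_of_reachable {A : Set (Sym2 V)} {u v : V}
    (h : (SimpleGraph.fromEdgeSet A).Reachable u v) :
    incidenceVec s(u, v) ∈ span (ZMod 2) (incidenceVec '' A) := by
  obtain ⟨walk⟩ := h
  induction walk with
  | nil => rw [incidenceVec_self]; exact zero_mem _
  | cons h_adj _ ih =>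
    rw [← incidenceVec_add_incidenceVec]
    exact add_mem (subset_span ⟨_, ((SimpleGraph.fromEdgeSet_adj _).1 h_adj).1, rfl⟩) ih

/-- The sum over the coordinates in the connected component of `u` is a linear form that vanishes on
all edges of the graph. -/
theorem reachable_of_incidenceVec_mem_span {A : Set (Sym2 V)} {u v : V}
    (h : incidenceVec s(u, v) ∈ span (ZMod 2) (incidenceVec '' A)) :
    (SimpleGraph.fromEdgeSet A).Reachable u v := by
  classical
  set H := SimpleGraph.fromEdgeSet A
  by_contra hn
  let componentSum : (V →₀ ZMod 2) →ₗ[ZMod 2] ZMod 2 :=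
    Finsupp.linearCombination (ZMod 2) fun x => if H.Reachable u x then (1 : ZMod 2) else 0
  have h_apply : ∀ a b, componentSum (incidenceVec s(a, b)) =
      (if H.Reachable u a then 1 else 0) + if H.Reachable u b then 1 else 0 := by
    simp [componentSum, incidenceVec_mk]
  have h_ker : span (ZMod 2) (incidenceVec '' A) ≤ LinearMap.ker componentSum := by
    rw [span_le]
    rintro _ ⟨e, he, rfl⟩
    induction e with | _ a b
    have h_iff : H.Reachable u a ↔ H.Reachable u b := by
      rcases eq_or_ne a b with rfl | hab
      · rfl
      · have h_adj : H.Adj a b := (SimpleGraph.fromEdgeSet_adj _).2 ⟨he, hab⟩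
        exact ⟨fun h => h.trans h_adj.reachable, fun h => h.trans h_adj.symm.reachable⟩
    rw [SetLike.mem_coe, LinearMap.mem_ker, h_apply]
    simp only [h_iff, CharTwo.add_self_eq_zero]
  have h_zero := LinearMap.mem_ker.1 (h_ker h)
  rw [h_apply, if_pos (SimpleGraph.Reachable.refl u), if_neg hn, add_zero] at h_zero
  exact one_ne_zero h_zero

theorem incidenceVec_mem_span_iff {A : Set (Sym2 V)} {u v : V} :
    incidenceVec s(u, v) ∈ span (ZMod 2) (incidenceVec '' A) ↔
      (SimpleGraph.fromEdgeSet A).Reachable u v :=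
  ⟨reachable_of_incidenceVec_mem_span, incidenceVec_mem_span_of_reachable⟩

theorem isAcyclic_fromEdgeSet_iff_linearIndepOn {A : Set (Sym2 V)} (hA : ∀ e ∈ A, ¬ e.IsDiag) :
    (SimpleGraph.fromEdgeSet A).IsAcyclic ↔ LinearIndepOn (ZMod 2) incidenceVec A := by
  have h_edgeSet : (SimpleGraph.fromEdgeSet A).edgeSet = A := by
    rw [SimpleGraph.edgeSet_fromEdgeSet, sdiff_eq_left, Set.disjoint_left]
    exact hA
  rw [SimpleGraph.isAcyclic_iff_forall_isBridge, linearIndepOn_iff_notMem_span, h_edgeSet]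
  refine forall₂_congr fun e _ => ?_
  induction e with | _ a b
  rw [incidenceVec_mem_span_iff, SimpleGraph.isBridge_iff, SimpleGraph.deleteEdges_fromEdgeSet]

namespace WeightedGraph

theorem isSpanningForest_iff_isSubfamilyBasis {G : WeightedGraph V} {F : Finset (Sym2 V)} :
    G.IsSpanningForest F ↔ IsSubfamilyBasis (ZMod 2) incidenceVec G.edges F := by
  have h_span : (∀ u v, (SimpleGraph.fromEdgeSet (G.edges : Set (Sym2 V))).Reachable u v →
      (SimpleGraph.fromEdgeSet (F : Set (Sym2 V))).Reachable u v) ↔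
      incidenceVec '' (G.edges : Set (Sym2 V)) ⊆
        span (ZMod 2) (incidenceVec '' (F : Set (Sym2 V))) := by
    simp only [← incidenceVec_mem_span_iff]
    refine ⟨?_, fun h u v huv => span_le.2 h huv⟩
    rintro h _ ⟨e, he, rfl⟩
    induction e with | _ a b
    exact h a b (subset_span ⟨_, he, rfl⟩)
  have h_acyclic (hF : F ⊆ G.edges) :=
    isAcyclic_fromEdgeSet_iff_linearIndepOn (A := F) fun e he => G.loopless e (hF he)
  exact ⟨fun ⟨h₁, h₂, h₃⟩ => ⟨h₁, (h_acyclic h₁).1 h₂, h_span.1 h₃⟩,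
    fun ⟨h₁, h₂, h₃⟩ => ⟨h₁, (h_acyclic h₁).2 h₂, h_span.2 h₃⟩⟩

theorem mstWeight_eq_sum {G : WeightedGraph V} {W : ℕ} (hW : ∀ e ∈ G.edges, G.weight e ≤ W) :
    G.mstWeight = ∑ i ∈ Finset.range W, (familyRank (ZMod 2) incidenceVec G.edges -
      familyRank (ZMod 2) incidenceVec (G.edges.filter (G.weight · ≤ i))) := by
  simp only [mstWeight, isSpanningForest_iff_isSubfamilyBasis]
  exact (isLeast_sum_isSubfamilyBasis hW).csInf_eq

end WeightedGraph

end GraphicMatroid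

section TotalVariation

variable {T : ℕ} {E : Type*} [SeminormedAddCommGroup E]

/-- The total variation of a finite sequence. -/
def totalVariation (f : Fin (T + 1) → E) : ℝ :=
  ∑ t : Fin T, ‖f t.succ - f t.castSucc‖

theorem totalVariation_sub_comm (f g : Fin (T + 1) → E) :
    totalVariation (fun t => f t - g t) = totalVariation fun t => g t - f t := by
  refine Finset.sum_congr rfl fun t _ => ?_
  rw [sub_sub_sub_comm, norm_sub_rev, sub_sub_sub_comm]

theorem totalVariation_sum_le {ι : Type*} (s : Finset ι) (f : ι → Fin (T + 1) → E) :
    totalVariation (fun t => ∑ i ∈ s, f i t) ≤ ∑ i ∈ s, totalVariation (f i) := by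
  simp only [totalVariation, ← Finset.sum_sub_distrib]
  rw [Finset.sum_comm]
  exact Finset.sum_le_sum fun t _ => norm_sum_le _ _

theorem totalVariation_sub_le_of_monotone {a b : Fin (T + 1) → ℝ} (ha : Monotone a)
    (hb : Monotone b) :
    totalVariation (fun t => a t - b t) ≤ a (Fin.last T) - a 0 + (b (Fin.last T) - b 0) := by
  have h_telescope : ∀ f : Fin (T + 1) → ℝ,
      ∑ t : Fin T, (f t.succ - f t.castSucc) = f (Fin.last T) - f 0 := by
    intro f
    rw [Finset.sum_sub_distrib]
    linarith [Fin.sum_univ_castSucc f, Fin.sum_univ_succ f]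
  rw [← h_telescope a, ← h_telescope b, ← Finset.sum_add_distrib]
  refine Finset.sum_le_sum fun t _ => ?_
  have h_le : t.castSucc ≤ t.succ := Fin.castSucc_lt_succ.le
  rw [Real.norm_eq_abs, abs_le]
  constructor <;> linarith [ha h_le, hb h_le]

end TotalVariation

section Sensitivity

variable {V : Type*} {T D W : ℕ} {v : V}

namespace WeightedGraph

variable {G G' : WeightedGraph V}

/-- `G'` arises from `G` by deleting all edges at the node `v`. -/
structure IsStarDeletion (G G' : WeightedGraph V) (v : V) : Prop where
  mem_edges_iff : ∀ e, e ∈ G'.edges ↔ e ∈ G.edges ∧ v ∉ e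
  weight_eq : ∀ e ∈ G'.edges, G'.weight e = G.weight e

theorem degree_eq_card_filter_mem [DecidableEq V] (G : WeightedGraph V) (v : V) :
    G.degree v = (G.edges.filter (v ∈ ·)).card := by
  rw [degree, ← Finset.coe_filter, Set.ncard_coe_finset]

theorem cast_mstWeight_eq_sum (hW : ∀ e ∈ G.edges, G.weight e ≤ W) :
    (G.mstWeight : ℝ) = ∑ i ∈ Finset.range W, ((G.edges.filter (i < G.weight ·)).card -
      nullityGain (ZMod 2) incidenceVec (i < G.weight ·) G.edges) := by
  simp only [mstWeight_eq_sum hW, ← familyRank_sub_familyRank_filter_not, not_lt, Nat.cast_sum]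

theorem IsStarDeletion.mstWeight_sub_mstWeight [DecidableEq V] (h : G.IsStarDeletion G' v)
    (hW : ∀ e ∈ G.edges, G.weight e ≤ W) :
    (G.mstWeight : ℝ) - G'.mstWeight = ∑ i ∈ Finset.range W,
      (((G.edges.filter (i < G.weight ·)).filter (v ∈ ·)).card +
        nullityGain (ZMod 2) incidenceVec (v ∈ ·) (G.edges.filter (G.weight · ≤ i)) -
        nullityGain (ZMod 2) incidenceVec (v ∈ ·) G.edges) := by
  have h_edges : G'.edges = G.edges.filter (v ∉ ·) := by
    ext e
    rw [h.mem_edges_iff, Finset.mem_filter]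
  have h_filter (p : ℕ → Prop) [DecidablePred p] :
      G'.edges.filter (fun e => p (G'.weight e)) =
        (G.edges.filter fun e => p (G.weight e)).filter (v ∉ ·) := by
    rw [Finset.filter_congr fun e he => by rw [h.weight_eq e he], h_edges, Finset.filter_comm]
  have hW' : ∀ e ∈ G'.edges, G'.weight e ≤ W := fun e he =>
    (h.weight_eq e he).trans_le (hW e ((h.mem_edges_iff e).1 he).1)
  rw [cast_mstWeight_eq_sum hW, cast_mstWeight_eq_sum hW', ← Finset.sum_sub_distrib]
  refine Finset.sum_congr rfl fun i _ => ?_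
  have h_split : (((G.edges.filter (i < G.weight ·)).filter (v ∈ ·)).card +
      ((G.edges.filter (i < G.weight ·)).filter (v ∉ ·)).card : ℝ) =
      (G.edges.filter (i < G.weight ·)).card := by
    exact_mod_cast Finset.card_filter_add_card_filter_not _
  simp only [nullityGain, not_lt]
  rw [h_filter (i < ·), h_filter (· ≤ i), ← h_split, ← h_edges]
  ring

theorem card_add_nullityGain_add_nullityGain_le [DecidableEq V] (G : WeightedGraph V) (v : V)
    (i : ℕ) :
    ((G.edges.filter (i < G.weight ·)).filter (v ∈ ·)).card +
        nullityGain (ZMod 2) incidenceVec (v ∈ ·) (G.edges.filter (G.weight · ≤ i)) +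
        nullityGain (ZMod 2) incidenceVec (v ∈ ·) G.edges ≤ 2 * G.degree v := by
  have h_split : (((G.edges.filter (i < G.weight ·)).filter (v ∈ ·)).card +
      ((G.edges.filter (G.weight · ≤ i)).filter (v ∈ ·)).card : ℝ) = G.degree v := by
    have h_card := Finset.card_filter_add_card_filter_not
      (s := G.edges.filter (v ∈ ·)) (i < G.weight ·)
    simp only [not_lt, Finset.filter_comm (v ∈ ·), ← degree_eq_card_filter_mem] at h_card
    exact_mod_cast h_card
  have h_low := nullityGain_le_card_filter (K := ZMod 2) (v := incidenceVec) (p := (v ∈ ·))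
    (G.edges.filter (G.weight · ≤ i))
  have h_all := nullityGain_le_card_filter (K := ZMod 2) (v := incidenceVec) (p := (v ∈ ·)) G.edges
  rw [← degree_eq_card_filter_mem] at h_all
  linarith

end WeightedGraph

namespace IncrementalSeq

theorem verts_mono (S : IncrementalSeq V T) : Monotone fun t => (S.graph t).verts :=
  Fin.monotone_iff_le_succ.2 S.verts_subset

theorem edges_mono (S : IncrementalSeq V T) : Monotone fun t => (S.graph t).edges :=
  Fin.monotone_iff_le_succ.2 S.edges_subset

theorem filter_weight_mono (S : IncrementalSeq V T) (p : ℕ → Prop) [DecidablePred p] :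
    Monotone fun t => (S.graph t).edges.filter fun e => p ((S.graph t).weight e) := by
  refine Fin.monotone_iff_le_succ.2 fun t e he => ?_
  obtain ⟨he, hp⟩ := Finset.mem_filter.1 he
  exact Finset.mem_filter.2 ⟨S.edges_subset t he, by rwa [S.weight_eq t e he]⟩

variable {S S' : IncrementalSeq V T}

theorem NodeAdjacentOn.notMem_of_mem_edges_zero (h : NodeAdjacentOn S S' v) :
    ∀ e ∈ (S.graph 0).edges, v ∉ e := by
  obtain ⟨-, ⟨t, ht, -⟩, -⟩ := h
  exact fun e he hv => ht.2 (S.verts_mono (Fin.zero_le _) ((S.graph 0).endpoints_mem e he v hv))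

theorem NodeAdjacentOn.isStarDeletion (h : NodeAdjacentOn S S' v) (t : Fin (T + 1)) :
    (S.graph t).IsStarDeletion (S'.graph t) v := by
  have h_initial := h.notMem_of_mem_edges_zero
  obtain ⟨h_zero, -, -, h_inserted, h_weight⟩ := h
  induction t using Fin.induction with
  | zero => exact ⟨fun e => by rw [← h_zero]; grind, fun e _ => by rw [h_zero]⟩
  | succ t ih =>
    constructor
    · intro e
      have h_old := ih.mem_edges_iff e
      have h_new : (e ∈ (S'.graph t.succ).edges ∧ e ∉ (S'.graph t.castSucc).edges) ↔
          (e ∈ (S.graph t.succ).edges ∧ e ∉ (S.graph t.castSucc).edges) ∧ v ∉ e :=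
        Set.ext_iff.1 (h_inserted t) e
      have h_keep := @S.edges_subset t e
      have h_keep' := @S'.edges_subset t e
      tauto
    · intro e he
      by_cases h_old : e ∈ (S'.graph t.castSucc).edges
      · rw [S'.weight_eq t e h_old, ih.weight_eq e h_old,
          S.weight_eq t e ((ih.mem_edges_iff e).1 h_old).1]
      · exact h_weight t e ⟨he, h_old⟩

theorem NodeAdjacentOn.totalVariation_mstWeight_sub_le (h : NodeAdjacentOn S S' v)
    (hS : S.Bounded D W) :
    totalVariation (fun t => ((S.graph t).mstWeight - (S'.graph t).mstWeight : ℝ)) ≤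
      2 * D * W := by
  classical
  let star (i : ℕ) (t : Fin (T + 1)) : ℝ :=
    (((S.graph t).edges.filter (i < (S.graph t).weight ·)).filter (v ∈ ·)).card
  let gain (E : Finset (Sym2 V)) : ℝ := nullityGain (ZMod 2) incidenceVec (v ∈ ·) E
  let low (i : ℕ) (t : Fin (T + 1)) := (S.graph t).edges.filter ((S.graph t).weight · ≤ i)
  have h_level (i : ℕ) :
      totalVariation (fun t => star i t + gain (low i t) - gain (S.graph t).edges) ≤ 2 * D := by
    have h_mono : Monotone fun t => star i t + gain (low i t) := by
      refine Monotone.add (fun s t hst => ?_) (nullityGain_mono.comp (S.filter_weight_mono (· ≤ i)))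
      exact Nat.cast_le.2 (Finset.card_le_card
        (Finset.filter_subset_filter _ (S.filter_weight_mono (i < ·) hst)))
    refine (totalVariation_sub_le_of_monotone h_mono (nullityGain_mono.comp S.edges_mono)).trans ?_
    have h_last : star i (Fin.last T) + gain (low i (Fin.last T)) +
        gain (S.graph (Fin.last T)).edges ≤ 2 * (S.graph (Fin.last T)).degree v :=
      (S.graph (Fin.last T)).card_add_nullityGain_add_nullityGain_le v i
    have h_degree : ((S.graph (Fin.last T)).degree v : ℝ) ≤ D := Nat.cast_le.2 ((hS _).1 v)
    have h_star_nonneg : 0 ≤ star i 0 := Nat.cast_nonneg _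
    have h_low_nonneg : 0 ≤ gain (low i 0) := nullityGain_nonneg _
    have h_nonneg : 0 ≤ gain (S.graph 0).edges := nullityGain_nonneg _
    simp only [Function.comp_apply]
    linarith
  calc _ = totalVariation (fun t => ∑ i ∈ Finset.range W,
        (star i t + gain (low i t) - gain (S.graph t).edges)) := by
        congr 1 with t
        exact (h.isStarDeletion t).mstWeight_sub_mstWeight fun e he => ((hS t).2 e he).2
    _ ≤ ∑ i ∈ Finset.range W, (2 * D : ℝ) :=
        (totalVariation_sum_le _ _).trans (Finset.sum_le_sum fun i _ => h_level i)
    _ = 2 * D * W := by rw [Finset.sum_const, Finset.card_range, nsmul_eq_mul]; ring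

theorem NodeAdjacent.totalVariation_mstWeight_sub_le (h : NodeAdjacent S S')
    (hS : S.Bounded D W) (hS' : S'.Bounded D W) :
    totalVariation (fun t => ((S.graph t).mstWeight - (S'.graph t).mstWeight : ℝ)) ≤
      2 * D * W := by
  obtain ⟨v, h | h⟩ := h
  · exact h.totalVariation_mstWeight_sub_le hS
  · rw [totalVariation_sub_comm]
    exact h.totalVariation_mstWeight_sub_le hS'

theorem NodeAdjacent.graph_zero_eq (h : NodeAdjacent S S') : S.graph 0 = S'.graph 0 := by
  obtain ⟨v, h | h⟩ := h
  exacts [h.1, h.1.symm]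

theorem sum_abs_diffSeq_sub_diffSeq (f : WeightedGraph V → ℝ) (S S' : IncrementalSeq V T) :
    ∑ t : Fin T, |S.diffSeq f t - S'.diffSeq f t| =
      totalVariation fun t => f (S.graph t) - f (S'.graph t) :=
  Finset.sum_congr rfl fun t _ => by rw [diffSeq, diffSeq, sub_sub_sub_comm, Real.norm_eq_abs]

end IncrementalSeq

theorem nodeSensitivity_le_ofReal_iff {f : WeightedGraph V → ℝ} {R : ℝ} (hR : 0 ≤ R) :
    nodeSensitivity f T D W ≤ ENNReal.ofReal R ↔ ∀ S S' : IncrementalSeq V T,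
      S.Bounded D W → S'.Bounded D W → S.NodeAdjacent S' →
        totalVariation (fun t => f (S.graph t) - f (S'.graph t)) ≤ R := by
  simp only [nodeSensitivity, iSup_le_iff, and_imp, IncrementalSeq.sum_abs_diffSeq_sub_diffSeq,
    ENNReal.ofReal_le_ofReal_iff hR]

theorem nodeSensitivity_mstWeight_le :
    nodeSensitivity (fun G : WeightedGraph V => (G.mstWeight : ℝ)) T D W
      ≤ ENNReal.ofReal (2 * D * W) :=
  (nodeSensitivity_le_ofReal_iff (by positivity)).2 fun _ _ hS hS' h =>
    h.totalVariation_mstWeight_sub_le hS hS'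

end Sensitivity

section ProductMeasures

open scoped NNReal

variable {ι : Type*} [Fintype ι] {X : ι → Type*} [∀ i, MeasurableSpace (X i)]
  {μ ν : ∀ i, Measure (X i)}

theorem measurePi_mono [∀ i, SigmaFinite (μ i)] (h : ∀ i, μ i ≤ ν i) :
    Measure.pi μ ≤ Measure.pi ν := by
  have h_outer : (Measure.pi μ).toOuterMeasure ≤
      OuterMeasure.pi fun i => (ν i).toOuterMeasure := by
    refine OuterMeasure.le_pi.2 fun s _ => ?_
    simpa only [Measure.coe_toOuterMeasure, Measure.pi_pi] using
      Finset.prod_le_prod' fun i _ => h i (s i)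
  refine Measure.le_iff.2 fun s hs => (h_outer s).trans_eq ?_
  rw [Measure.pi, toMeasure_apply _ _ hs]

theorem measurePi_smul [∀ i, SigmaFinite (μ i)] (c : ι → ℝ≥0) :
    Measure.pi (fun i => c i • μ i) = (∏ i, c i) • Measure.pi μ := by
  refine Measure.pi_eq fun s _ => ?_
  simp only [Measure.smul_apply, Measure.pi_pi, ENNReal.smul_def, smul_eq_mul,
    Finset.prod_mul_distrib, ENNReal.ofNNReal_finsetProd]

end ProductMeasures

section LaplaceNoise

open Real ProbabilityTheory

/-- The standard Laplace distribution, with density `exp (-|x|) / 2`. -/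
noncomputable def laplaceMeasure : Measure ℝ :=
  volume.withDensity fun x => ENNReal.ofReal (exp (-|x|) / 2)

theorem exp_neg_abs_add_mul_eqOn_Iic (c : ℝ) :
    Set.EqOn (fun x : ℝ => exp (-|x| + c * x)) (fun x => exp ((1 + c) * x)) (Set.Iic 0) :=
  fun x hx => by
    simp only [abs_of_nonpos (Set.mem_Iic.1 hx)]
    ring_nf

theorem exp_neg_abs_add_mul_eqOn_Ioi (c : ℝ) :
    Set.EqOn (fun x : ℝ => exp (-|x| + c * x)) (fun x => exp ((c - 1) * x)) (Set.Ioi 0) :=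
  fun x hx => by
    simp only [abs_of_pos (Set.mem_Ioi.1 hx)]
    ring_nf

theorem integrable_exp_neg_abs_add_mul {c : ℝ} (hc : |c| < 1) :
    Integrable fun x : ℝ => exp (-|x| + c * x) := by
  obtain ⟨h_gt, h_lt⟩ := abs_lt.1 hc
  rw [← integrableOn_univ, ← Set.Iic_union_Ioi (a := 0)]
  exact ((integrableOn_exp_mul_Iic (by linarith) 0).congr_fun
      (exp_neg_abs_add_mul_eqOn_Iic c).symm measurableSet_Iic).union
    ((integrableOn_exp_mul_Ioi (by linarith) 0).congr_fun
      (exp_neg_abs_add_mul_eqOn_Ioi c).symm measurableSet_Ioi)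

theorem integral_exp_neg_abs_add_mul {c : ℝ} (hc : |c| < 1) :
    ∫ x : ℝ, exp (-|x| + c * x) = 2 * (1 - c ^ 2)⁻¹ := by
  obtain ⟨h_gt, h_lt⟩ := abs_lt.1 hc
  have h_int := integrable_exp_neg_abs_add_mul hc
  have h_add : 1 + c ≠ 0 := by linarith
  have h_sub : 1 - c ≠ 0 := by linarith
  have h_sub' : c - 1 ≠ 0 := by linarith
  have h_sq : 1 - c ^ 2 = (1 + c) * (1 - c) := by ring
  rw [← intervalIntegral.integral_Iic_add_Ioi h_int.integrableOn h_int.integrableOn (b := 0),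
    setIntegral_congr_fun measurableSet_Iic (exp_neg_abs_add_mul_eqOn_Iic c),
    setIntegral_congr_fun measurableSet_Ioi (exp_neg_abs_add_mul_eqOn_Ioi c),
    integral_exp_mul_Iic (by linarith), integral_exp_mul_Ioi (by linarith), h_sq, mul_zero,
    mul_zero, exp_zero]
  field_simp
  ring

theorem integrable_exp_mul_laplaceMeasure {c : ℝ} (hc : |c| < 1) :
    Integrable (fun x => exp (c * x)) laplaceMeasure := by
  rw [laplaceMeasure, integrable_withDensity_iff_integrable_smul' (by fun_prop) (by simp)]
  refine ((integrable_exp_neg_abs_add_mul hc).div_const 2).congr (.of_forall fun x => ?_)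
  simp only [ENNReal.toReal_ofReal (by positivity : 0 ≤ exp (-|x|) / 2), smul_eq_mul, exp_add]
  ring

theorem mgf_id_laplaceMeasure {c : ℝ} (hc : |c| < 1) :
    mgf id laplaceMeasure c = (1 - c ^ 2)⁻¹ := by
  rw [mgf, laplaceMeasure, integral_withDensity_eq_integral_toReal_smul (by fun_prop) (by simp)]
  calc _ = ∫ x : ℝ, exp (-|x| + c * x) / 2 := by
        refine integral_congr_ae (.of_forall fun x => ?_)
        simp only [ENNReal.toReal_ofReal (by positivity : 0 ≤ exp (-|x|) / 2), smul_eq_mul,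
          exp_add, id_eq]
        ring
    _ = _ := by
        rw [integral_div, integral_exp_neg_abs_add_mul hc]
        ring

instance isProbabilityMeasure_laplaceMeasure : IsProbabilityMeasure laplaceMeasure := by
  refine ⟨?_⟩
  have h_mgf := mgf_id_laplaceMeasure (c := 0) (by simp)
  simp only [mgf_zero', ne_eq, OfNat.ofNat_ne_zero, not_false_eq_true, zero_pow, sub_zero, inv_one,
    Measure.real, ENNReal.toReal_eq_one_iff] at h_mgf
  exact h_mgf

theorem map_add_right_laplaceMeasure_le (s : ℝ) :
    laplaceMeasure.map (· + s) ≤ (exp |s|).toNNReal • laplaceMeasure := by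
  refine Measure.le_iff.2 fun B hB => ?_
  have h_meas : Measurable fun x : ℝ => ENNReal.ofReal (exp (-|x|) / 2) := by fun_prop
  have hB' : MeasurableSet ((· + s) ⁻¹' B) := measurable_add_const s hB
  have h_density (x : ℝ) : exp (-|x - s|) / 2 ≤ exp |s| * (exp (-|x|) / 2) := by
    rw [mul_div_assoc', ← exp_add]
    gcongr
    linarith [abs_sub_abs_le_abs_sub x s]
  rw [Measure.map_apply (measurable_add_const s) hB, Measure.smul_apply, laplaceMeasure,
    withDensity_apply _ hB, withDensity_apply _ hB', ENNReal.smul_def, smul_eq_mul,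
    ← lintegral_const_mul _ h_meas, ← lintegral_indicator hB, ← lintegral_indicator hB',
    ← lintegral_sub_right_eq_self _ s]
  refine lintegral_mono fun x => ?_
  by_cases hx : x ∈ B
  · rw [Set.indicator_of_mem hx, Set.indicator_of_mem (by simpa using hx)]
    exact (ENNReal.ofReal_le_ofReal (h_density x)).trans_eq (ENNReal.ofReal_mul (by positivity))
  · rw [Set.indicator_of_notMem hx, Set.indicator_of_notMem (by simpa using hx)]

theorem map_add_right_measurePi_laplaceMeasure_le {ι : Type*} [Fintype ι] (s : ι → ℝ) :
    (Measure.pi fun _ => laplaceMeasure).map (· + s) ≤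
      (exp (∑ i, |s i|)).toNNReal • Measure.pi fun _ => laplaceMeasure := by
  have h_prod : (exp (∑ i, |s i|)).toNNReal = ∏ i, (exp |s i|).toNNReal := by
    rw [exp_sum, toNNReal_prod_of_nonneg fun i _ => (exp_pos _).le]
  have (i : ι) : IsProbabilityMeasure (laplaceMeasure.map (· + s i)) :=
    Measure.isProbabilityMeasure_map (by fun_prop)
  rw [h_prod, ← measurePi_smul]
  refine le_of_eq_of_le ?_ (measurePi_mono fun i => map_add_right_laplaceMeasure_le (s i))
  exact Measure.pi_map_pi (f := fun i x => x + s i) fun _ => by fun_prop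

section ConcentrationOfSums

variable {Ω ι : Type*} [MeasurableSpace Ω] {μ : Measure Ω} {X : ι → Ω → ℝ}

theorem integrable_exp_mul_of_map_eq_laplaceMeasure {Y : Ω → ℝ} (hY : Measurable Y)
    (h_law : μ.map Y = laplaceMeasure) {c : ℝ} (hc : |c| < 1) :
    Integrable (fun ω => exp (c * Y ω)) μ :=
  (h_law ▸ integrable_exp_mul_laplaceMeasure hc).comp_measurable hY

theorem mgf_sum_laplace (hX : ∀ i, Measurable (X i)) (h_law : ∀ i, μ.map (X i) = laplaceMeasure)
    (h_indep : iIndepFun X μ) (I : Finset ι) {c : ℝ} (hc : |c| < 1) :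
    mgf (∑ i ∈ I, X i) μ c = ((1 - c ^ 2) ^ I.card)⁻¹ := by
  have h_mgf (i : ι) : mgf (X i) μ c = (1 - c ^ 2)⁻¹ := by
    rw [← mgf_id_map (hX i).aemeasurable, h_law i, mgf_id_laplaceMeasure hc]
  rw [h_indep.mgf_sum hX, Finset.prod_congr rfl fun i _ => h_mgf i, Finset.prod_const, inv_pow]

theorem abs_lt_one_of_sq_mul_eq_one {n : ℕ} {c : ℝ} (hc : c ^ 2 * (2 * n) = 1) : |c| < 1 := by
  have hn : (1 : ℝ) ≤ n := by
    rw [Nat.one_le_cast, Nat.one_le_iff_ne_zero]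
    rintro rfl
    simp at hc
  rw [← sq_lt_one_iff_abs_lt_one]
  nlinarith

theorem inv_one_sub_sq_pow_le_two {n : ℕ} {c : ℝ} (hc : c ^ 2 * (2 * n) = 1) :
    ((1 - c ^ 2) ^ n)⁻¹ ≤ 2 := by
  have h_sq := (sq_lt_one_iff_abs_lt_one c).2 (abs_lt_one_of_sq_mul_eq_one hc)
  have h_bernoulli := one_add_mul_le_pow (a := -c ^ 2) (by linarith) n
  rw [← sub_eq_add_neg] at h_bernoulli
  refine inv_le_of_inv_le₀ (by norm_num) ?_
  linarith

theorem measureReal_le_abs_mul_le [IsFiniteMeasure μ] {Y : Ω → ℝ} {c : ℝ}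
    (h_int : Integrable (fun ω => exp (c * Y ω)) μ)
    (h_int_neg : Integrable (fun ω => exp (-c * Y ω)) μ) (a : ℝ) :
    μ.real {ω | a ≤ |c * Y ω|} ≤ (mgf Y μ c + mgf Y μ (-c)) * exp (-a) := by
  have h_chernoff {d : ℝ} (hd : Integrable (fun ω => exp (d * Y ω)) μ) :
      μ.real {ω | a ≤ d * Y ω} ≤ exp (-a) * mgf Y μ d := by
    have h_le := measure_ge_le_exp_mul_mgf (X := fun ω => d * Y ω) a zero_le_one (by simpa using hd)
    rwa [mgf_const_mul, neg_one_mul, mul_one] at h_le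
  have h_sub : {ω | a ≤ |c * Y ω|} ⊆ {ω | a ≤ c * Y ω} ∪ {ω | a ≤ -c * Y ω} := by
    intro ω hω
    simpa only [Set.mem_union, Set.mem_ofPred_eq, neg_mul] using le_abs.1 hω
  calc μ.real {ω | a ≤ |c * Y ω|}
      ≤ μ.real {ω | a ≤ c * Y ω} + μ.real {ω | a ≤ -c * Y ω} :=
        (measureReal_mono h_sub).trans (measureReal_union_le _ _)
    _ ≤ exp (-a) * mgf Y μ c + exp (-a) * mgf Y μ (-c) :=
        add_le_add (h_chernoff h_int) (h_chernoff h_int_neg)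
    _ = (mgf Y μ c + mgf Y μ (-c)) * exp (-a) := by ring

theorem measureReal_le_abs_sum_laplace_le [IsFiniteMeasure μ] (hX : ∀ i, Measurable (X i))
    (h_law : ∀ i, μ.map (X i) = laplaceMeasure) (h_indep : iIndepFun X μ) {I : Finset ι}
    (hI : I.Nonempty) (a : ℝ) :
    μ.real {ω | a ≤ |(∑ i ∈ I, X i ω) / √(2 * I.card)|} ≤ 4 * exp (-a) := by
  have h_card : (0 : ℝ) < 2 * I.card := by simpa using hI.card_pos
  set c := (√(2 * I.card))⁻¹ with hc
  have h_sq : c ^ 2 * (2 * I.card) = 1 := by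
    rw [hc, inv_pow, sq_sqrt h_card.le, inv_mul_cancel₀ h_card.ne']
  have h_sq_neg : (-c) ^ 2 * (2 * I.card) = 1 := by rw [neg_sq, h_sq]
  have h_mgf {d : ℝ} (hd : d ^ 2 * (2 * I.card) = 1) : mgf (∑ i ∈ I, X i) μ d ≤ 2 := by
    rw [mgf_sum_laplace hX h_law h_indep I (abs_lt_one_of_sq_mul_eq_one hd)]
    exact inv_one_sub_sq_pow_le_two hd
  have h_int {d : ℝ} (hd : d ^ 2 * (2 * I.card) = 1) :
      Integrable (fun ω => exp (d * (∑ i ∈ I, X i) ω)) μ :=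
    h_indep.integrable_exp_mul_sum hX fun i _ =>
      integrable_exp_mul_of_map_eq_laplaceMeasure (hX i) (h_law i) (abs_lt_one_of_sq_mul_eq_one hd)
  have h_tail := measureReal_le_abs_mul_le (h_int h_sq) (h_int h_sq_neg) a
  simp only [Finset.sum_apply, hc, ← div_eq_inv_mul] at h_tail
  refine h_tail.trans ?_
  gcongr
  linarith [h_mgf h_sq, h_mgf h_sq_neg]

end ConcentrationOfSums

end LaplaceNoise

section UniformSmoothing

open Real ProbabilityTheory

/-- The uniform distribution on `[-1, 1]`. -/
noncomputable def uniformMeasure : Measure ℝ := volume[|Set.Icc (-1) 1]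

instance isProbabilityMeasure_uniformMeasure : IsProbabilityMeasure uniformMeasure :=
  cond_isProbabilityMeasure_of_finite (by simp) (by simp)

theorem uniformMeasure_real_Icc {a b : ℝ} (hab : Set.Icc a b ⊆ Set.Icc (-1) 1) :
    uniformMeasure.real (Set.Icc a b) = max (b - a) 0 / 2 := by
  rw [uniformMeasure, measureReal_def, cond_apply measurableSet_Icc, Set.inter_eq_right.2 hab,
    ENNReal.toReal_mul, ENNReal.toReal_inv, ← measureReal_def, ← measureReal_def,
    volume_real_Icc_of_le (by norm_num), volume_real_Icc]
  ring

theorem div_le_uniformMeasure_abs_add_mul_le {y r R : ℝ} (hR : 0 < R) (h : |y| + r ≤ R) :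
    r / R ≤ uniformMeasure.real {u | |y + R * u| ≤ r} := by
  obtain ⟨h_lower, h_upper⟩ := abs_le.1 (le_sub_iff_add_le.2 h)
  have h_sub : Set.Icc ((-r - y) / R) ((r - y) / R) ⊆ {u | |y + R * u| ≤ r} := by
    rintro u ⟨h_left, h_right⟩
    rw [div_le_iff₀ hR] at h_left
    rw [le_div_iff₀ hR] at h_right
    rw [Set.mem_ofPred_eq, abs_le]
    constructor <;> linarith
  have h_unit : Set.Icc ((-r - y) / R) ((r - y) / R) ⊆ Set.Icc (-1) 1 := by
    refine Set.Icc_subset_Icc ?_ ?_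
    · rw [le_div_iff₀ hR]
      linarith
    · rw [div_le_iff₀ hR]
      linarith
  calc r / R = ((r - y) / R - (-r - y) / R) / 2 := by ring
    _ ≤ max ((r - y) / R - (-r - y) / R) 0 / 2 := by
        gcongr
        exact le_max_left _ _
    _ = uniformMeasure.real (Set.Icc ((-r - y) / R) ((r - y) / R)) :=
        (uniformMeasure_real_Icc h_unit).symm
    _ ≤ _ := measureReal_mono h_sub

theorem uniformMeasure_abs_add_mul_le_eq_one {y r R : ℝ} (hR : 0 ≤ R) (h : |y| + R ≤ r) :
    uniformMeasure.real {u | |y + R * u| ≤ r} = 1 := by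
  have h_sub : Set.Icc (-1) 1 ⊆ {u : ℝ | |y + R * u| ≤ r} := fun u hu => by
    calc |y + R * u| ≤ |y| + R * |u| := by
          simpa only [abs_mul, abs_of_nonneg hR] using abs_add_le y (R * u)
      _ ≤ |y| + R * 1 := by
          gcongr
          exact abs_le.2 hu
      _ ≤ r := by linarith
  refine le_antisymm measureReal_le_one ?_
  calc 1 = uniformMeasure.real (Set.Icc (-1) 1) := by
        rw [uniformMeasure_real_Icc subset_rfl]
        norm_num
    _ ≤ _ := measureReal_mono h_sub

theorem mul_measureReal_le_measureReal_prod {α β : Type*} [MeasurableSpace α] [MeasurableSpace β]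
    {μ : Measure α} {ν : Measure β} [IsFiniteMeasure μ] [IsFiniteMeasure ν] {A : Set α}
    {B : Set (α × β)} (hA : MeasurableSet A) (hB : MeasurableSet B) {p : ℝ}
    (h : ∀ x ∈ A, p ≤ ν.real (Prod.mk x ⁻¹' B)) : p * μ.real A ≤ (μ.prod ν).real B := by
  have h_enn : ENNReal.ofReal p * μ A ≤ (μ.prod ν) B := by
    rw [Measure.prod_apply hB, ← setLIntegral_const]
    refine (setLIntegral_mono' hA fun x hx => ?_).trans (setLIntegral_le_lintegral A _)
    exact ENNReal.ofReal_le_of_le_toReal (h x hx)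
  calc p * μ.real A ≤ (ENNReal.ofReal p * μ A).toReal := by
        rw [ENNReal.toReal_mul, ENNReal.toReal_ofReal']
        exact mul_le_mul_of_nonneg_right (le_max_left _ _) measureReal_nonneg
    _ ≤ _ := ENNReal.toReal_mono (measure_ne_top _ _) h_enn

theorem two_pow_mul_exp_neg_le_one (n : ℕ) : 2 ^ n * exp (-n) ≤ 1 := by
  have h_two : (2 : ℝ) ≤ exp 1 := by linarith [add_one_le_exp 1]
  calc 2 ^ n * exp (-n) ≤ exp 1 ^ n * exp (-n) := by gcongr
    _ = 1 := by rw [exp_one_pow, ← exp_add, add_neg_cancel, exp_zero]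

variable {Ω : Type*} [MeasurableSpace Ω] {μ : Measure Ω} {Y : Ω → ℝ}

theorem mul_measureReal_abs_lt_le [IsFiniteMeasure μ]
    (hY : Measurable Y) {a p r R : ℝ}
    (h : ∀ y, |y| < a → p ≤ uniformMeasure.real {u | |y + R * u| ≤ r}) :
    p * μ.real {ω | |Y ω| < a} ≤
      (μ.prod uniformMeasure).real {x | |Y x.1 + R * x.2| ≤ r} :=
  mul_measureReal_le_measureReal_prod (measurableSet_lt hY.abs measurable_const)
    (measurableSet_le (by fun_prop) measurable_const) fun ω hω => h (Y ω) hω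

-- As `s → 0` the exponential tail bound alone becomes void, while the success probability only has
-- to be about `s`: this is what the bounded density of the uniform summand provides.
theorem one_sub_exp_neg_le_measureReal_abs_add_mul_uniform [IsProbabilityMeasure μ]
    (hY : Measurable Y)
    (h_tail : ∀ a, μ.real {ω | a ≤ |Y ω|} ≤ 4 * exp (-a)) {s : ℝ} (hs : 0 < s) :
    1 - exp (-s) ≤ (μ.prod uniformMeasure).real {p | |Y p.1 + 12 * p.2| ≤ 30 * s} := by
  have h_concentration (a : ℝ) : 1 - 4 * exp (-a) ≤ μ.real {ω | |Y ω| < a} := by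
    have h_compl : {ω | |Y ω| < a} = {ω | a ≤ |Y ω|}ᶜ := by
      ext
      simp
    rw [h_compl, probReal_compl_eq_one_sub (measurableSet_le measurable_const hY.abs)]
    linarith [h_tail a]
  rcases le_or_gt (1 / 2) s with h_large | h_small
  · have h_exp : 4 * exp (-(30 * s - 12)) ≤ exp (-s) := by
      calc 4 * exp (-(30 * s - 12)) ≤ 4 * exp (-2 + -s) := by
            gcongr
            linarith
        _ = (2 ^ 2 * exp (-(2 : ℕ))) * exp (-s) := by
            rw [exp_add]
            norm_num
            ring
        _ ≤ exp (-s) := mul_le_of_le_one_left (exp_pos _).le (two_pow_mul_exp_neg_le_one 2)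
    have h_le : 1 * μ.real {ω | |Y ω| < 30 * s - 12} ≤
        (μ.prod uniformMeasure).real {p | |Y p.1 + 12 * p.2| ≤ 30 * s} :=
      mul_measureReal_abs_lt_le hY fun y hy =>
        (uniformMeasure_abs_add_mul_le_eq_one (by norm_num) (by linarith)).ge
    linarith [h_concentration (30 * s - 12)]
  · set r := min (30 * s) 8 with hr
    have h_le : r / 12 * μ.real {ω | |Y ω| < 4} ≤
        (μ.prod uniformMeasure).real {p | |Y p.1 + 12 * p.2| ≤ 30 * s} :=
      mul_measureReal_abs_lt_le hY fun y hy =>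
        (div_le_uniformMeasure_abs_add_mul_le (by norm_num)
          (by linarith [min_le_right (30 * s) 8])).trans
        (measureReal_mono fun u (hu : _ ≤ r) => hu.trans (min_le_left _ _))
    have h_half : 3 / 4 ≤ μ.real {ω | |Y ω| < 4} := by
      have h_exp := two_pow_mul_exp_neg_le_one 4
      push_cast at h_exp
      linarith [h_concentration 4]
    have h_r : s ≤ r / 12 * (3 / 4) := by
      rcases min_choice (30 * s) 8 with h_min | h_min <;> rw [hr, h_min] <;> linarith
    have h_mul := mul_le_mul_of_nonneg_left h_half (a := r / 12) (by positivity)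
    linarith [add_one_le_exp (-s)]

end UniformSmoothing

section DyadicDecomposition

theorem sum_range_dyadic_telescope {E : Type*} [AddCommGroup E] (A : ℕ → E) {n L : ℕ}
    (hn : n < 2 ^ L) :
    ∑ l ∈ Finset.range L, (A (n / 2 ^ l * 2 ^ l) - A (n / 2 ^ l / 2 * 2 * 2 ^ l)) =
      A n - A 0 := by
  have h_next (l : ℕ) : n / 2 ^ l / 2 * 2 * 2 ^ l = n / 2 ^ (l + 1) * 2 ^ (l + 1) := by
    rw [Nat.div_div_eq_div_mul, ← pow_succ, mul_assoc, ← pow_succ']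
  simp only [h_next]
  rw [Finset.sum_range_sub' fun l => A (n / 2 ^ l * 2 ^ l), Nat.div_eq_of_lt hn, pow_zero,
    Nat.div_one, mul_one, zero_mul]

variable {E : Type*} [SeminormedAddCommGroup E] {T : ℕ}

theorem sum_norm_block_sub_le (A : ℕ → E) (m k : ℕ) :
    ∑ p ∈ Finset.range k, ‖A ((p + 1) * m) - A (p * m)‖ ≤
      ∑ j ∈ Finset.range (k * m), ‖A (j + 1) - A j‖ := by
  induction k with
  | zero => simp
  | succ k ih =>
    have h_le : k * m ≤ (k + 1) * m := Nat.mul_le_mul_right m k.le_succ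
    have h_triangle := dist_le_Ico_sum_dist A h_le
    rw [Finset.sum_range_succ, ← Finset.sum_range_add_sum_Ico _ h_le]
    simp only [dist_eq_norm'] at h_triangle
    exact add_le_add ih h_triangle

theorem sum_norm_dyadic_sub_le (A : ℕ → E) (m k : ℕ) :
    ∑ q ∈ Finset.range (k + 1), ‖A (q * m) - A (q / 2 * 2 * m)‖ ≤
      ∑ j ∈ Finset.range (k * m), ‖A (j + 1) - A j‖ := by
  rw [Finset.sum_range_succ', Nat.zero_div, zero_mul, zero_mul, zero_mul, sub_self, norm_zero,
    add_zero]
  refine (Finset.sum_le_sum fun p _ => ?_).trans (sum_norm_block_sub_le A m k)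
  rcases Nat.even_or_odd' p with ⟨r, rfl | rfl⟩
  · rw [show (2 * r + 1) / 2 * 2 = 2 * r by omega]
  · rw [show (2 * r + 1 + 1) / 2 * 2 = 2 * r + 1 + 1 by omega, sub_self, norm_zero]
    exact norm_nonneg _

/-- The dyadic blocks of time steps up to `T`: the pair `⟨l, q⟩` stands for the `q`-th block of
length `2 ^ l`, counted from `1`. The position `q = 0` stands for the empty block. -/
abbrev DyadicNode (T : ℕ) : Type := (l : Fin (Nat.log 2 T + 1)) × Fin (T / 2 ^ (l : ℕ) + 1)

/-- The dyadic blocks whose increments add up to the increment over the first `t + 1` time steps,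
one at each level: the block ending last within them. Blocks at even positions, whose increment is
`0`, are kept so that all paths have the same length. -/
def dyadicPath (t : Fin T) : Finset (DyadicNode T) :=
  Finset.univ.map ⟨fun l => ⟨l, (t + 1) / 2 ^ (l : ℕ),
    Nat.lt_succ_of_le (Nat.div_le_div_right t.isLt)⟩, fun _ _ h => congrArg Sigma.fst h⟩

theorem card_dyadicPath (t : Fin T) : (dyadicPath t).card = Nat.log 2 T + 1 := by
  rw [dyadicPath, Finset.card_map, Finset.card_univ, Fintype.card_fin]

/-- The increment of `f` over a dyadic block, set to `0` at even positions: there it is covered by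
the block of twice the length that ends at the same time. -/
def dyadicIncrement (f : Fin (T + 1) → E) (i : DyadicNode T) : E :=
  f (Fin.ofNat _ (i.2 * 2 ^ (i.1 : ℕ))) - f (Fin.ofNat _ (i.2 / 2 * 2 * 2 ^ (i.1 : ℕ)))

theorem sum_dyadicPath_dyadicIncrement (f : Fin (T + 1) → E) (t : Fin T) :
    ∑ i ∈ dyadicPath t, dyadicIncrement f i = f t.succ - f 0 := by
  have h_lt : (t : ℕ) + 1 < 2 ^ (Nat.log 2 T + 1) :=
    (Nat.succ_le_of_lt t.isLt).trans_lt (Nat.lt_pow_succ_log_self one_lt_two T)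
  have h_telescope := sum_range_dyadic_telescope (fun n => f (Fin.ofNat _ n)) h_lt
  rw [Finset.sum_range] at h_telescope
  rw [dyadicPath, Finset.sum_map]
  refine h_telescope.trans ?_
  congr 2
  exact Fin.ext (Nat.mod_eq_of_lt (by omega))

theorem totalVariation_eq_sum_range (f : Fin (T + 1) → E) :
    totalVariation f =
      ∑ j ∈ Finset.range T, ‖f (Fin.ofNat _ (j + 1)) - f (Fin.ofNat _ j)‖ := by
  rw [Finset.sum_range]
  refine Finset.sum_congr rfl fun t _ => ?_
  congr 3
  all_goals exact Fin.ext (Nat.mod_eq_of_lt (by omega)).symm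

theorem sum_norm_dyadicIncrement_le (f : Fin (T + 1) → E) :
    ∑ i, ‖dyadicIncrement f i‖ ≤ (Nat.log 2 T + 1 : ℕ) * totalVariation f := by
  have h_level (l : Fin (Nat.log 2 T + 1)) :
      ∑ q, ‖dyadicIncrement f ⟨l, q⟩‖ ≤ totalVariation f := by
    rw [totalVariation_eq_sum_range]
    refine (Finset.sum_range _).symm.trans_le ((sum_norm_dyadic_sub_le
      (fun n => f (Fin.ofNat _ n)) (2 ^ (l : ℕ)) (T / 2 ^ (l : ℕ))).trans ?_)
    exact Finset.sum_le_sum_of_subset_of_nonneg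
      (Finset.range_mono (Nat.div_mul_le_self _ _)) fun _ _ _ => norm_nonneg _
  rw [Fintype.sum_sigma]
  refine (Finset.sum_le_sum fun l _ => h_level l).trans_eq ?_
  rw [Finset.sum_const, Finset.card_univ, Fintype.card_fin, nsmul_eq_mul]

end DyadicDecomposition

section TreeMechanism

open Real ProbabilityTheory

variable {V : Type*} {T D W : ℕ} {f : WeightedGraph V → ℝ} {b ε : ℝ}

/-- The binary tree mechanism for a graph function `f`: it releases `f (G_t)`, perturbed by the sum
of independent Laplace noises of scale `b` at the dyadic blocks on the path of `t`. A uniform noise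
of the same order of magnitude is added to make the output concentrated also at confidence levels
close to `0`. -/
noncomputable def treeMechanism (f : WeightedGraph V → ℝ) (T : ℕ) (b : ℝ) :
    ContinualAlgorithm V T where
  Coins := (DyadicNode T → ℝ) × ℝ
  law := (Measure.pi fun _ => laplaceMeasure).prod uniformMeasure
  output S ω t := f (S.graph t.succ) +
    b * (∑ i ∈ dyadicPath t, ω.1 i + √(2 * (Nat.log 2 T + 1 : ℕ)) * (12 * ω.2))
  measurable_output S := by fun_prop
  causal S S' t h ω := by rw [h t.succ le_rfl]

theorem exists_sum_abs_le_forall_mul_sum_dyadicPath_eq (hb : 0 ≤ b) (hε : 0 ≤ ε)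
    {g : Fin (T + 1) → ℝ} (hg : g 0 = 0) (h_le : (Nat.log 2 T + 1 : ℕ) * totalVariation g ≤ b * ε) :
    ∃ s : DyadicNode T → ℝ, ∑ i, |s i| ≤ ε ∧
      ∀ t : Fin T, b * ∑ i ∈ dyadicPath t, s i = g t.succ := by
  have h_sum : ∑ i, |dyadicIncrement g i| ≤ b * ε := (sum_norm_dyadicIncrement_le g).trans h_le
  have h_cancel (i : DyadicNode T) : b * (dyadicIncrement g i / b) = dyadicIncrement g i := by
    refine mul_div_cancel_of_imp' fun h_zero => abs_nonpos_iff.1 ?_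
    rw [h_zero, zero_mul] at h_sum
    exact (Finset.single_le_sum (fun j _ => abs_nonneg _) (Finset.mem_univ i)).trans h_sum
  refine ⟨fun i => dyadicIncrement g i / b, ?_, fun t => ?_⟩
  · simp only [abs_div, abs_of_nonneg hb]
    rw [← Finset.sum_div]
    exact div_le_of_le_mul₀ hb hε (by rwa [mul_comm])
  · rw [Finset.mul_sum, Finset.sum_congr rfl fun i _ => h_cancel i,
      sum_dyadicPath_dyadicIncrement, hg, sub_zero]

theorem map_add_right_prod_measurePi_laplaceMeasure_le {ι β : Type*} [Fintype ι]
    [MeasurableSpace β] (ν : Measure β) [SFinite ν] (s : ι → ℝ) :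
    ((Measure.pi fun _ => laplaceMeasure).prod ν).map (Prod.map (· + s) id) ≤
      (exp (∑ i, |s i|)).toNNReal • (Measure.pi fun _ => laplaceMeasure).prod ν := by
  rw [← Measure.map_prod_map _ _ (measurable_add_const s) measurable_id, Measure.map_id,
    ← Measure.prod_smul_left]
  exact Measure.prod_mono (map_add_right_measurePi_laplaceMeasure_le s) le_rfl

theorem treeMechanism_nodePrivate (hb : 0 ≤ b) (hε : 0 ≤ ε)
    (hf : nodeSensitivity f T D W ≤ ENNReal.ofReal (b * ε / (Nat.log 2 T + 1 : ℕ))) :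
    (treeMechanism f T b).NodePrivate ε D W := by
  intro S S' hS hS' h_adj B hB
  let law : Measure ((DyadicNode T → ℝ) × ℝ) :=
    (Measure.pi fun _ => laplaceMeasure).prod uniformMeasure
  let F : IncrementalSeq V T → (DyadicNode T → ℝ) × ℝ → Fin T → ℝ := (treeMechanism f T b).output
  have h_variation := (nodeSensitivity_le_ofReal_iff (by positivity)).1 hf S S' hS hS' h_adj
  rw [le_div_iff₀' (by positivity)] at h_variation
  obtain ⟨s, h_norm, h_path⟩ := exists_sum_abs_le_forall_mul_sum_dyadicPath_eq hb hε
    (by rw [h_adj.graph_zero_eq, sub_self]) h_variation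
  have h_shift : F S ⁻¹' B = Prod.map (· + s) id ⁻¹' (F S' ⁻¹' B) := by
    have h_output : F S = F S' ∘ Prod.map (· + s) id := by
      ext ω t
      simp only [F, treeMechanism, Function.comp_apply, Prod.map_fst, Prod.map_snd, id_eq,
        Pi.add_apply, Finset.sum_add_distrib]
      linarith [h_path t]
    rw [h_output, Set.preimage_comp]
  have h_meas : MeasurableSet (F S' ⁻¹' B) := (treeMechanism f T b).measurable_output S' hB
  have h_le : law (F S ⁻¹' B) ≤ (exp ε).toNNReal • law (F S' ⁻¹' B) := by
    rw [h_shift, ← Measure.map_apply (by fun_prop) h_meas]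
    refine (map_add_right_prod_measurePi_laplaceMeasure_le uniformMeasure s _).trans ?_
    simp only [Measure.smul_apply]
    gcongr
  rw [ENNReal.smul_def, smul_eq_mul] at h_le
  have h_real := ENNReal.toReal_mono
    (ENNReal.mul_ne_top ENNReal.coe_ne_top (measure_ne_top _ _)) h_le
  rwa [ENNReal.toReal_mul, ENNReal.coe_toReal, coe_toNNReal _ (exp_pos ε).le] at h_real

theorem measureReal_le_abs_sum_dyadicPath_le (t : Fin T) (a : ℝ) :
    (Measure.pi fun _ : DyadicNode T => laplaceMeasure).real
        {x | a ≤ |(∑ i ∈ dyadicPath t, x i) / √(2 * (Nat.log 2 T + 1 : ℕ))|} ≤ 4 * exp (-a) := by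
  have h_nonempty : (dyadicPath t).Nonempty := by
    rw [← Finset.card_pos, card_dyadicPath]
    exact Nat.succ_pos _
  have h_tail := measureReal_le_abs_sum_laplace_le measurable_pi_apply
    (fun i => (measurePreserving_eval (fun _ : DyadicNode T => laplaceMeasure) i).map_eq)
    (iIndepFun_pi fun _ => aemeasurable_id) h_nonempty a
  rwa [card_dyadicPath] at h_tail

theorem one_sub_exp_neg_le_pr_treeMechanism (hb : 0 ≤ b) {s : ℝ} (hs : 0 < s)
    (S : IncrementalSeq V T) (t : Fin T) :
    1 - exp (-s) ≤ (treeMechanism f T b).pr fun ω =>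
      |(treeMechanism f T b).output S ω t - f (S.graph t.succ)| ≤
        b * (√(2 * (Nat.log 2 T + 1 : ℕ)) * (30 * s)) := by
  let σ : ℝ := √(2 * (Nat.log 2 T + 1 : ℕ))
  have hσ : 0 < σ := sqrt_pos.2 (by positivity)
  refine (one_sub_exp_neg_le_measureReal_abs_add_mul_uniform (by fun_prop)
    (measureReal_le_abs_sum_dyadicPath_le t) hs).trans ?_
  refine measureReal_mono (μ := (Measure.pi fun _ => laplaceMeasure).prod uniformMeasure) ?_
  rintro ⟨x, u⟩ h
  rw [Set.mem_ofPred_eq] at h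
  have h_error : (treeMechanism f T b).output S (x, u) t - f (S.graph t.succ) =
      b * (σ * ((∑ i ∈ dyadicPath t, x i) / σ + 12 * u)) := by
    rw [mul_add σ, mul_div_cancel₀ _ hσ.ne']
    exact add_sub_cancel_left _ _
  have h_bound : |(treeMechanism f T b).output S (x, u) t - f (S.graph t.succ)| ≤
      b * (σ * (30 * s)) := by
    rw [h_error, abs_mul, abs_mul, abs_of_nonneg hb, abs_of_pos hσ]
    gcongr
  exact h_bound

end TreeMechanism

theorem ContinualAlgorithm.pr_mono {V : Type*} {T : ℕ} (A : ContinualAlgorithm V T)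
    {p q : A.Coins → Prop} (h : ∀ ω, p ω → q ω) : A.pr p ≤ A.pr q := by
  let _ := A.measurableSpace
  have _ := A.isProbabilityMeasure
  exact measureReal_mono (μ := A.law) h

theorem natLog_two_add_one_le_mul_log {T : ℕ} (hT : 2 ≤ T) :
    ((Nat.log 2 T + 1 : ℕ) : ℝ) ≤ 3 * Real.log T := by
  have h_log_two_le : Real.log 2 ≤ Real.log T :=
    Real.log_le_log (by norm_num) (by exact_mod_cast hT)
  have h_natLog : Nat.log 2 T * Real.log 2 ≤ Real.log T := by
    rw [← le_div_iff₀ (Real.log_pos one_lt_two)]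
    exact Real.natLog_le_logb T 2
  have : (0 : ℝ) ≤ Nat.log 2 T := Nat.cast_nonneg _
  push_cast
  nlinarith [Real.log_two_gt_d9]

theorem natLog_two_add_one_mul_sqrt_le {T : ℕ} (hT : 2 ≤ T) :
    ((Nat.log 2 T + 1 : ℕ) : ℝ) * √(2 * (Nat.log 2 T + 1 : ℕ)) ≤
      9 * Real.log T ^ (3 / 2 : ℝ) := by
  have h_log : 0 < Real.log T := Real.log_pos (by exact_mod_cast hT)
  have h_depth := natLog_two_add_one_le_mul_log hT
  have h_sqrt : √(2 * (Nat.log 2 T + 1 : ℕ)) ≤ 3 * √(Real.log T) := by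
    rw [Real.sqrt_le_left (by positivity), mul_pow, Real.sq_sqrt h_log.le]
    linarith
  calc _ ≤ 3 * Real.log T * (3 * √(Real.log T)) := by gcongr
    _ = 9 * (Real.log T ^ (1 : ℝ) * Real.log T ^ (1 / 2 : ℝ)) := by
      rw [Real.rpow_one, ← Real.sqrt_eq_rpow]
      ring
    _ = 9 * Real.log T ^ (3 / 2 : ℝ) := by
      rw [← Real.rpow_add h_log]
      norm_num

theorem exists_nodePrivate_of_nodeSensitivity_le {V : Type*} {T D W : ℕ} (hT : 2 ≤ T)
    {f : WeightedGraph V → ℝ} {R : ℝ} (hR : 0 ≤ R)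
    (hf : nodeSensitivity f T D W ≤ ENNReal.ofReal R) {ε : ℝ} (hε : 0 < ε) :
    ∃ A : ContinualAlgorithm V T, A.NodePrivate ε D W ∧
      ∀ δ : ℝ, 0 < δ → δ < 1 → ∀ (S : IncrementalSeq V T) (t : Fin T),
        1 - δ ≤ A.pr fun ω => |A.output S ω t - f (S.graph t.succ)| ≤
          270 * (R * ε⁻¹ * Real.log T ^ (3 / 2 : ℝ) * Real.log δ⁻¹) := by
  let k : ℝ := (Nat.log 2 T + 1 : ℕ)
  have hk : 0 < k := by positivity
  have h_scale : k * R / ε * ε / k = R := by field_simp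
  refine ⟨treeMechanism f T (k * R / ε), treeMechanism_nodePrivate (by positivity) hε.le
    (by rwa [h_scale]), fun δ hδ hδ' S t => ?_⟩
  have h_log : 0 < Real.log δ⁻¹ := Real.log_pos ((one_lt_inv₀ hδ).2 hδ')
  have h_acc := one_sub_exp_neg_le_pr_treeMechanism (f := f) (b := k * R / ε) (by positivity)
    h_log S t
  rw [Real.log_inv, neg_neg, Real.exp_log hδ, ← Real.log_inv] at h_acc
  refine h_acc.trans (ContinualAlgorithm.pr_mono _ fun ω hω => hω.trans ?_)
  calc k * R / ε * (√(2 * k) * (30 * Real.log δ⁻¹))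
      = 30 * (R * ε⁻¹ * Real.log δ⁻¹) * (k * √(2 * k)) := by ring
    _ ≤ 30 * (R * ε⁻¹ * Real.log δ⁻¹) * (9 * Real.log T ^ (3 / 2 : ℝ)) :=
      mul_le_mul_of_nonneg_left (natLog_two_add_one_mul_sqrt_le hT) (by positivity)
    _ = 270 * (R * ε⁻¹ * Real.log T ^ (3 / 2 : ℝ) * Real.log δ⁻¹) := by ring

theorem mainTheorem5_general :
    (∀ (V : Type*) (T D W : ℕ),
      nodeSensitivity (fun G : WeightedGraph V => (G.mstWeight : ℝ)) T D W
        ≤ ((2 * D * W : ℕ) : ENNReal)) ∧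
    ∃ C : ℝ, 0 < C ∧
      ∀ (V : Type*) (T D W : ℕ) (ε : ℝ), 2 ≤ T → 0 < ε →
        ∃ A : ContinualAlgorithm V T,
          A.NodePrivate ε D W ∧
          ∀ δ : ℝ, 0 < δ → δ < 1 → ∀ (S : IncrementalSeq V T) (t : Fin T),
            1 - δ ≤ A.pr (fun ω =>
              |A.output S ω t - ((S.graph t.succ).mstWeight : ℝ)|
                ≤ C * ((D : ℝ) * (W : ℝ) * ε⁻¹ * (Real.log T) ^ (3 / 2 : ℝ)
                    * Real.log δ⁻¹)) := by
  refine ⟨fun V T D W => ?_, 540, by norm_num, fun V T D W ε hT hε => ?_⟩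
  · rw [← ENNReal.ofReal_natCast]
    exact_mod_cast nodeSensitivity_mstWeight_le
  · obtain ⟨A, h_private, h_acc⟩ := exists_nodePrivate_of_nodeSensitivity_le hT
      (by positivity) (nodeSensitivity_mstWeight_le (V := V) (D := D) (W := W)) hε
    refine ⟨A, h_private, fun δ hδ hδ' S t =>
      (h_acc δ hδ hδ' S t).trans (A.pr_mono fun ω hω => hω.trans_eq ?_)⟩
    ring

theorem mainTheorem5 :
    (∀ (V : Type*) (T D W : ℕ),
      nodeSensitivity (fun G : WeightedGraph V => (G.mstWeight : ℝ)) T D W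
        ≤ ((2 * D * W : ℕ) : ENNReal)) ∧
    ∃ C : ℝ, 0 < C ∧
      ∀ (V : Type*) (T D W : ℕ) (ε : ℝ), 2 ≤ T → 0 < ε →
        ∃ A : ContinualAlgorithm V T,
          A.NodePrivate ε D W ∧
          ∀ δ : ℝ, 0 < δ → δ < 1 →
            ∀ S : IncrementalSeq V T, S.Bounded D W → ∀ t : Fin T,
              1 - δ ≤ A.pr (fun ω =>
                |A.output S ω t - ((S.graph t.succ).mstWeight : ℝ)|
                  ≤ C * ((D : ℝ) * (W : ℝ) * ε⁻¹ * (Real.log T) ^ (3 / 2 : ℝ)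
                      * Real.log δ⁻¹)) := by
  obtain ⟨h_sens, C, hC, h⟩ := mainTheorem5_general
  exact ⟨h_sens, C, hC, fun V T D W ε hT hε => (h V T D W ε hT hε).imp
    fun _ ⟨h_private, h_acc⟩ => ⟨h_private, fun δ hδ hδ' S _ => h_acc δ hδ hδ' S⟩⟩
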